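/- Let $G$ be a five-dimensional (real, smooth) Lie group whose Lie algebra $\mathfrak g$ is the four-step nilpotent Lie algebra $\mathfrak l_{5,7}$: $\mathfrak g$ has a basis $E_1,\dots,E_5$ in which the brackets are $$[E_1,E_2]=aE_3+bE_4+cE_5,\qquad [E_1,E_3]=dE_4+fE_5,\qquad [E_1,E_4]=gE_5,$$ all other brackets $[E_i,E_j]$ with $i<j$ being zero, where $a,d,g>0$ and either $b>0$, or $b=0$ and $f\ge 0$. Let $\tilde a$ be the left-invariant Riemannian metric on $G$ for which $E_1,\dots,E_5$ is orthonormal, let $X$ be a left-invariant vector field on $G$ with $\sqrt{\tilde a(X,X)}<1$, and let $$F(x,v)=\sqrt{\tilde a(v,v)}+\tilde a(X(x),v),\qquad v\in T_xG,$$ be the associated left-invariant Randers metric. Suppose that $F$ is of Douglas type, that is, in every standard local coordinate system $(x^i,y^i)$ of $TG$ its spray coefficients $G^i=\tfrac14 g^{il}\big([F^2]_{x^my^l}y^m-[F^2]_{x^l}\big)$, where $(g^{il})$ is the inverse of $g_{il}=\tfrac12[F^2]_{y^iy^l}$, have the form $G^i=\tfrac12\Gamma^i_{jk}(x)y^jy^k+P(x,y)y^i$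 for $y\ne 0$, with $P$ positively homogeneous of degree one in $y$. A nonzero vector $Y\in\mathfrak g$ is called a geodesic vector of $(G,F)$ if the one-parameter subgroup $t\mapsto\exp(tY)$ is a geodesic of $F$, that is, if it solves $\ddot x^i+2G^i(x,\dot x)=0$ in local coordinates. Then a nonzero vector $Y=y_1E_1+y_2E_2+y_3E_3+y_4E_4+y_5E_5\in\mathfrak g$ is a geodesic vector of $(G,F)$ if and only if either $Y\in\mathrm{span}\{E_1,E_2\}$, or $Y$ is orthogonal to $E_1$ with respect to $\tilde a$ and $$y_2(ay_3+by_4+cy_5)+y_3(dy_4+fy_5)+g\,y_4y_5=0.$$ -/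

import Mathlib

open scoped Manifold ContDiff

namespace DouglasRanders

noncomputable section

/-! ### Spray, geodesics and Douglas condition of a Finsler function -/

/-- A real function on the tangent bundle of an `n`-dimensional manifold. -/
abbrev TangentFunction (n : ℕ) (M : Type*) [TopologicalSpace M]
    [ChartedSpace (EuclideanSpace ℝ (Fin n)) M] : Type _ :=
  (p : M) → TangentSpace (𝓡 n) p → ℝ

/-- The `i`-th partial derivative `∂f/∂xⁱ` of a function of `n` real variables. -/
def partialDeriv {n : ℕ} (i : Fin n) (f : EuclideanSpace ℝ (Fin n) → ℝ)
    (x : EuclideanSpace ℝ (Fin n)) : ℝ :=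
  fderiv ℝ f x (EuclideanSpace.single i (1 : ℝ))

section Finsler

variable {n : ℕ} {M : Type*} [TopologicalSpace M] [ChartedSpace (EuclideanSpace ℝ (Fin n)) M]

/-- The function `F²` in the standard local coordinates `(x, y)` of the tangent bundle which are
induced by the chart `φ`: the tangent vector with coordinates `(x, y)` is `d(φ⁻¹)ₓ y`. -/
def energyInChart (F : TangentFunction n M)
    (φ : OpenPartialHomeomorph M (EuclideanSpace ℝ (Fin n)))
    (x y : EuclideanSpace ℝ (Fin n)) : ℝ :=
  F (φ.symm x) (mfderiv (𝓡 n) (𝓡 n) φ.symm x y) ^ 2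

/-- The fundamental tensor `g_{ij} = ½ ∂²F² / ∂yⁱ∂yʲ` in the chart `φ`. -/
def fundamentalTensor (F : TangentFunction n M)
    (φ : OpenPartialHomeomorph M (EuclideanSpace ℝ (Fin n)))
    (x y : EuclideanSpace ℝ (Fin n)) : Matrix (Fin n) (Fin n) ℝ :=
  Matrix.of fun i j =>
    (1 / 2 : ℝ) * partialDeriv i (fun v => partialDeriv j (energyInChart F φ x) v) y

/-- The spray coefficients `Gⁱ = ¼ g^{il} ([F²]_{xᵐ yˡ} yᵐ - [F²]_{xˡ})` in the chart `φ`. -/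
def sprayCoeff (F : TangentFunction n M)
    (φ : OpenPartialHomeomorph M (EuclideanSpace ℝ (Fin n)))
    (x y : EuclideanSpace ℝ (Fin n)) (i : Fin n) : ℝ :=
  (1 / 4 : ℝ) * ∑ l, (fundamentalTensor F φ x y)⁻¹ i l *
    ((∑ m, partialDeriv m (fun u => partialDeriv l (energyInChart F φ u) y) x * y m) -
      partialDeriv l (fun u => energyInChart F φ u y) x)

/-- `F` is of Douglas type: in every chart of the smooth structure the spray coefficients are
`Gⁱ = ½ Γⁱ_{jk}(x) yʲ yᵏ + P(x, y) yⁱ` on nonzero tangent vectors, where `P` is positively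
homogeneous of degree one in `y`. -/
def IsDouglas (F : TangentFunction n M) : Prop :=
  ∀ φ ∈ IsManifold.maximalAtlas (𝓡 n) ∞ M,
    ∃ (Γ : EuclideanSpace ℝ (Fin n) → Fin n → Fin n → Fin n → ℝ)
      (P : EuclideanSpace ℝ (Fin n) → EuclideanSpace ℝ (Fin n) → ℝ),
      (∀ x ∈ φ.target, ∀ y, y ≠ 0 → ∀ r : ℝ, 0 < r → P x (r • y) = r * P x y) ∧
      ∀ x ∈ φ.target, ∀ y, y ≠ 0 → ∀ i,
        sprayCoeff F φ x y i = (1 / 2 : ℝ) * (∑ j, ∑ k, Γ x i j k * y j * y k) + P x y * y i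

/-- `γ : ℝ → M` is a (regular, constant speed) geodesic of `F`: it is of class `C²`, its velocity
vanishes nowhere, and in every chart of the smooth structure it solves
`d²xⁱ/dt² + 2 Gⁱ(x, dx/dt) = 0`. -/
def IsGeodesic (F : TangentFunction n M) (γ : ℝ → M) : Prop :=
  ContMDiff 𝓘(ℝ, ℝ) (𝓡 n) 2 γ ∧
  ∀ φ ∈ IsManifold.maximalAtlas (𝓡 n) ∞ M, ∀ t : ℝ, γ t ∈ φ.source →
    deriv (φ ∘ γ) t ≠ 0 ∧
    ∀ i, deriv (deriv (φ ∘ γ)) t i + 2 * sprayCoeff F φ (φ (γ t)) (deriv (φ ∘ γ) t) i = 0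

end Finsler

/-! ### Left-invariant Randers metrics and geodesic vectors -/

section LieGroups

variable {n : ℕ} {G : Type*} [TopologicalSpace G] [ChartedSpace (EuclideanSpace ℝ (Fin n)) G]
  [Group G] [LieGroup (𝓡 n) ∞ G]

variable (n G) in
/-- Smooth Riemannian metrics on `G`. -/
abbrev RiemMetric : Type _ :=
  Bundle.ContMDiffRiemannianMetric (𝓡 n) ∞ (EuclideanSpace ℝ (Fin n))
    (fun p : G => TangentSpace (𝓡 n) p)

/-- The Riemannian metric is invariant under all left translations. -/
def IsLeftInvariant (a : RiemMetric n G) : Prop :=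
  ∀ (g p : G) (u v : TangentSpace (𝓡 n) p),
    a.inner (g * p) (mfderiv (𝓡 n) (𝓡 n) (fun q : G => g * q) p u)
      (mfderiv (𝓡 n) (𝓡 n) (fun q : G => g * q) p v) = a.inner p u v

/-- The Randers function `F(p, v) = √(a(v, v)) + a(X(p), v)` defined by the Riemannian metric `a`
and the left-invariant vector field with value `X` at the identity. -/
def randers (a : RiemMetric n G) (X : GroupLieAlgebra (𝓡 n) G) : TangentFunction n G :=
  fun p v => Real.sqrt (a.inner p v v) +
    a.inner p (mulInvariantVectorField (I := 𝓡 n) X p) v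

/-- `Y` is a geodesic vector of `(G, F)`: `Y ≠ 0` and the one-parameter subgroup `t ↦ exp (t Y)`,
that is, the integral curve through `1` of the left-invariant vector field defined by `Y`, is a
geodesic of `F`. -/
def IsGeodesicVector (F : TangentFunction n G) (Y : GroupLieAlgebra (𝓡 n) G) : Prop :=
  Y ≠ 0 ∧ ∃ γ : ℝ → G, γ 0 = 1 ∧
    IsMIntegralCurve (I := 𝓡 n) γ (mulInvariantVectorField (I := 𝓡 n) Y) ∧ IsGeodesic F γ

end LieGroups

/-! ### The Lie algebra `𝔩₅,₇` -/

/-- The basis `E₁, …, E₅` (indexed by `0, …, 4`) of a real Lie algebra has the brackets of the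
four-step nilpotent Lie algebra `𝔩₅,₇` with parameters `a, b, c, d, f, g`. -/
structure IsL57Basis {L : Type*} [AddCommGroup L] [Module ℝ L] [Bracket L L]
    (E : Module.Basis (Fin 5) ℝ L) (a b c d f g : ℝ) : Prop where
  a_pos : 0 < a
  d_pos : 0 < d
  g_pos : 0 < g
  b_f : 0 < b ∨ (b = 0 ∧ 0 ≤ f)
  b12 : ⁅E 0, E 1⁆ = a • E 2 + b • E 3 + c • E 4
  b13 : ⁅E 0, E 2⁆ = d • E 3 + f • E 4
  b14 : ⁅E 0, E 3⁆ = g • E 4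
  b15 : ⁅E 0, E 4⁆ = 0
  b23 : ⁅E 1, E 2⁆ = 0
  b24 : ⁅E 1, E 3⁆ = 0
  b25 : ⁅E 1, E 4⁆ = 0
  b34 : ⁅E 2, E 3⁆ = 0
  b35 : ⁅E 2, E 4⁆ = 0
  b45 : ⁅E 3, E 4⁆ = 0

end

end DouglasRanders

/-! Pulled back by the left Maurer-Cartan form `Θ`, the metric becomes one fixed Minkowski norm `N =
√B + B X` on the Lie algebra: `F² = N² ∘ Θ` in any chart. All dependence on the base point sits in
`Θ`, and the antisymmetric part of its derivative is minus the bracket. So, with `w = Θ y`, the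
spray is determined by `Hess(N²)_w (Θ S - DΘ(y) y, z) = -d(N²)_w [w, z]` (`randersHessian_spray`).
Along an integral curve of `Y` the velocity satisfies `Θ(c') = Y`. As the Hessian is positive
definite, the geodesic equation reduces to `dN_Y [Y, z] = 0` for all `z` (`geodesic_equation_iff`).

For a Douglas metric the left argument of the Hessian is an even function of `w` plus a multiple of
`w`. Eliminating the multiple leaves an identity whose only odd term is `√(B w w) · B(X, [w, z])`.
Hence `X` is orthogonal to the derived algebra (`IsDouglas.innerOne_groupBracket_eq_zero`), and the
criterion becomes the Riemannian one, `B(Y, [Y, z]) = 0`. For `𝔩₅,₇` this is a small polynomial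
system (`IsL57Basis.forall_apply_lie_eq_zero_iff`). -/

namespace DouglasRanders

noncomputable section

/-! ### Randers norms on a vector space: derivatives and strong convexity. -/

section MinkowskiNorm

variable {V : Type*} [NormedAddCommGroup V] [NormedSpace ℝ V]

/-- The Minkowski norm of Randers type given by a scalar product `B` and a vector `X`. -/
def randersNorm (B : V →L[ℝ] V →L[ℝ] ℝ) (X w : V) : ℝ :=
  Real.sqrt (B w w) + B X w

/-- The differential of `randersNorm B X` at a nonzero vector. -/
def randersNormDeriv (B : V →L[ℝ] V →L[ℝ] ℝ) (X w : V) : V →L[ℝ] ℝ :=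
  (Real.sqrt (B w w))⁻¹ • B w + B X

/-- The Hessian of `randersNorm B X ^ 2` at a nonzero vector. -/
def randersHessian (B : V →L[ℝ] V →L[ℝ] ℝ) (X w u v : V) : ℝ :=
  2 * (randersNormDeriv B X w u * randersNormDeriv B X w v + randersNorm B X w *
    (Real.sqrt (B w w))⁻¹ * (B u v - B w u * B w v / B w w))

variable {B : V →L[ℝ] V →L[ℝ] ℝ} {X w : V}

lemma sq_apply_le (hs : ∀ u v, B u v = B v u) (hp : ∀ u, u ≠ 0 → 0 < B u u) (u v : V) :
    B u v ^ 2 ≤ B u u * B v v := by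
  rcases eq_or_ne v 0 with rfl | hv
  · simp
  have h0 : 0 ≤ B (B v v • u - B u v • v) (B v v • u - B u v • v) := by
    rcases eq_or_ne (B v v • u - B u v • v) 0 with h | h
    · simp [h]
    · exact (hp _ h).le
  have h1 : B (B v v • u - B u v • v) (B v v • u - B u v • v)
      = B v v * (B u u * B v v - B u v ^ 2) := by
    simp only [map_sub, map_smul, _root_.sub_apply, _root_.smul_apply,
      smul_eq_mul, hs v u]
    ring
  rw [h1] at h0
  have := nonneg_of_mul_nonneg_right h0 (hp v hv)
  linarith

lemma sq_apply_lt (hs : ∀ u v, B u v = B v u) (hp : ∀ u, u ≠ 0 → 0 < B u u) {u v : V}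
    (h : ∀ t : ℝ, v ≠ t • u) (hu : u ≠ 0) : B u v ^ 2 < B u u * B v v := by
  have h0 : 0 < B (B u u • v - B u v • u) (B u u • v - B u v • u) := by
    refine hp _ fun h' => h ((B u u)⁻¹ * B u v) ?_
    rw [mul_smul, ← sub_eq_zero.1 h', smul_smul, inv_mul_cancel₀ (hp u hu).ne', one_smul]
  have h1 : B (B u u • v - B u v • u) (B u u • v - B u v • u)
      = B u u * (B u u * B v v - B u v ^ 2) := by
    simp only [map_sub, map_smul, _root_.sub_apply, _root_.smul_apply,
      smul_eq_mul, hs v u]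
    ring
  rw [h1] at h0
  have := pos_of_mul_pos_right h0 (hp u hu).le
  linarith

/-- By Cauchy-Schwarz and `‖X‖ < 1`, the linear term is smaller in absolute value than the
Riemannian one. -/
lemma randersNorm_pos (hs : ∀ u v, B u v = B v u) (hp : ∀ u, u ≠ 0 → 0 < B u u)
    (hX : Real.sqrt (B X X) < 1) (hw : w ≠ 0) : 0 < randersNorm B X w := by
  have h1 : |B X w| ≤ Real.sqrt (B X X) * Real.sqrt (B w w) := by
    rw [← Real.sqrt_mul' _ (hp w hw).le]
    exact Real.abs_le_sqrt (sq_apply_le hs hp X w)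
  have h2 := Real.sqrt_pos.2 (hp w hw)
  have h3 := neg_abs_le (B X w)
  unfold randersNorm
  nlinarith

lemma hasFDerivAt_apply_self (hs : ∀ u v, B u v = B v u) (w : V) :
    HasFDerivAt (fun v => B v v) ((2 : ℝ) • B w) w := by
  refine (B.hasFDerivAt.clm_apply (hasFDerivAt_id w)).congr_fderiv ?_
  ext v
  simp [hs v w, two_mul]

lemma hasFDerivAt_sqrt_apply_self (hs : ∀ u v, B u v = B v u) (hp : ∀ u, u ≠ 0 → 0 < B u u)
    (hw : w ≠ 0) :
    HasFDerivAt (fun v => Real.sqrt (B v v)) ((Real.sqrt (B w w))⁻¹ • B w) w := by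
  refine ((hasFDerivAt_apply_self hs w).sqrt (hp w hw).ne').congr_fderiv ?_
  rw [smul_smul]
  congr 1
  field_simp

lemma hasFDerivAt_randersNorm (hs : ∀ u v, B u v = B v u) (hp : ∀ u, u ≠ 0 → 0 < B u u)
    (hw : w ≠ 0) : HasFDerivAt (randersNorm B X) (randersNormDeriv B X w) w :=
  (hasFDerivAt_sqrt_apply_self hs hp hw).add (B X).hasFDerivAt

lemma contDiffAt_sq_randersNorm (hp : ∀ u, u ≠ 0 → 0 < B u u) (hw : w ≠ 0) :
    ContDiffAt ℝ ∞ (fun v => randersNorm B X v ^ 2) w := by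
  have h1 : ContDiffAt ℝ ∞ (fun v => B v v) w :=
    B.contDiff.contDiffAt.clm_apply contDiffAt_id
  exact ((h1.sqrt (hp w hw).ne').add (B X).contDiff.contDiffAt).pow 2

lemma fderiv_sq_randersNorm (hs : ∀ u v, B u v = B v u) (hp : ∀ u, u ≠ 0 → 0 < B u u)
    (hw : w ≠ 0) : fderiv ℝ (fun v => randersNorm B X v ^ 2) w =
      (2 * randersNorm B X w) • randersNormDeriv B X w := by
  rw [((hasFDerivAt_randersNorm hs hp hw).pow 2).fderiv]
  simp

lemma fderiv_fderiv_sq_randersNorm (hs : ∀ u v, B u v = B v u) (hp : ∀ u, u ≠ 0 → 0 < B u u)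
    (hw : w ≠ 0) (u v : V) :
    fderiv ℝ (fderiv ℝ (fun v => randersNorm B X v ^ 2)) w u v = randersHessian B X w u v := by
  have hd : DifferentiableAt ℝ (fderiv ℝ (fun v => randersNorm B X v ^ 2)) w :=
    ((contDiffAt_sq_randersNorm hp hw).fderiv_right (m := 1) (by norm_cast)).differentiableAt
      one_ne_zero
  -- The formula for the first derivative holds only off the origin, so it is differentiated as a
  -- germ at `w`.
  have he : (fun z => fderiv ℝ (fun v => randersNorm B X v ^ 2) z v) =ᶠ[nhds w]
      fun z => (2 * randersNorm B X z) * ((Real.sqrt (B z z))⁻¹ * B z v + B X v) := by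
    filter_upwards [isOpen_ne.mem_nhds hw] with z hz
    rw [fderiv_sq_randersNorm hs hp hz]
    rfl
  have hpos := hp w hw
  have hα := Real.sqrt_pos.2 hpos
  have hsq := Real.sq_sqrt hpos.le
  have h1 := ((hasFDerivAt_randersNorm (X := X) hs hp hw).const_mul 2).mul
    ((((hasDerivAt_inv hα.ne').comp_hasFDerivAt w (hasFDerivAt_sqrt_apply_self hs hp hw)).mul
      (B.hasFDerivAt.clm_apply (hasFDerivAt_const v w))).add_const (B X v))
  have h2 := hd.hasFDerivAt.clm_apply (hasFDerivAt_const v w)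
  have h3 := congrArg (fun T : V →L[ℝ] ℝ => T u) (h2.unique (h1.congr_of_eventuallyEq he))
  simp only [ContinuousLinearMap.comp_zero, zero_add, ContinuousLinearMap.flip_apply] at h3
  rw [h3]
  simp only [randersHessian, randersNormDeriv, _root_.add_apply, _root_.smul_apply, smul_eq_mul,
    ContinuousLinearMap.flip_apply, Function.comp_apply, Pi.mul_apply]
  generalize Real.sqrt (B w w) = α at *
  rw [← hsq]
  field_simp
  ring

/-- Euler's relation: `N` is 1-homogeneous, so `dN_w w = N w`, and the angular part of the Hessian
annihilates `w`. -/
lemma randersHessian_self_left (hp : ∀ u, u ≠ 0 → 0 < B u u)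
    (hw : w ≠ 0) (v : V) : randersHessian B X w w v =
      2 * randersNorm B X w * randersNormDeriv B X w v := by
  have hpos := hp w hw
  have hα := Real.sqrt_pos.2 hpos
  have hsq := Real.mul_self_sqrt hpos.le
  have h1 : randersNormDeriv B X w w = randersNorm B X w := by
    simp only [randersNormDeriv, randersNorm, _root_.add_apply,
      _root_.smul_apply, smul_eq_mul]
    congr 1
    field_simp
    linarith
  rw [randersHessian, h1]
  field_simp
  ring

/-- The Hessian is the square of `dN_w` plus a positive multiple of the angular form. The first is
positive on the line of `w`; the second is positive off it, by strict Cauchy-Schwarz. -/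
lemma randersHessian_pos (hs : ∀ u v, B u v = B v u) (hp : ∀ u, u ≠ 0 → 0 < B u u)
    (hX : Real.sqrt (B X X) < 1) (hw : w ≠ 0) {u : V} (hu : u ≠ 0) :
    0 < randersHessian B X w u u := by
  have hpos := hp w hw
  have hα := Real.sqrt_pos.2 hpos
  have hN := randersNorm_pos hs hp hX hw
  by_cases h : ∃ t : ℝ, u = t • w
  · obtain ⟨t, rfl⟩ := h
    have ht : t ≠ 0 := by rintro rfl; simp at hu
    have h1 : randersHessian B X w (t • w) (t • w) = t ^ 2 * randersHessian B X w w w := by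
      simp only [randersHessian, map_smul, _root_.smul_apply, smul_eq_mul]
      ring
    have h2 : randersNormDeriv B X w w = randersNorm B X w := by
      simp only [randersNormDeriv, randersNorm, _root_.add_apply,
        _root_.smul_apply, smul_eq_mul]
      congr 1
      have hsq := Real.mul_self_sqrt hpos.le
      field_simp
      linarith
    rw [h1, randersHessian_self_left hp hw, h2]
    positivity
  · push Not at h
    have h1 := sq_apply_lt hs hp h hw
    have h2 : 0 < B u u - B w u * B w u / B w w := by
      rw [sub_pos, div_lt_iff₀ hpos]
      nlinarith
    have h3 : 0 < randersNorm B X w * (Real.sqrt (B w w))⁻¹ *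
        (B u u - B w u * B w u / B w w) := by positivity
    have h4 := mul_self_nonneg (randersNormDeriv B X w u)
    unfold randersHessian
    linarith

end MinkowskiNorm

/-! ### Spray of a function whose square is `h (Θ x y)` in a chart. -/

section Spray

open Filter Topology

variable {n : ℕ} {M : Type*} [TopologicalSpace M] [ChartedSpace (EuclideanSpace ℝ (Fin n)) M]
  {F : TangentFunction n M} {φ : OpenPartialHomeomorph M (EuclideanSpace ℝ (Fin n))}
  {h : EuclideanSpace ℝ (Fin n) → ℝ}
  {Θ : EuclideanSpace ℝ (Fin n) → EuclideanSpace ℝ (Fin n) →L[ℝ] EuclideanSpace ℝ (Fin n)}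
  {Θ' : EuclideanSpace ℝ (Fin n) →L[ℝ] EuclideanSpace ℝ (Fin n) →L[ℝ] EuclideanSpace ℝ (Fin n)}
  {x y : EuclideanSpace ℝ (Fin n)}

lemma partialDeriv_energyInChart (hK : ∀ v, energyInChart F φ x v = h (Θ x v))
    (hh : DifferentiableAt ℝ h (Θ x y)) (l : Fin n) :
    partialDeriv l (energyInChart F φ x) y =
      fderiv ℝ h (Θ x y) (Θ x (EuclideanSpace.single l 1)) := by
  have h1 : energyInChart F φ x = h ∘ Θ x := funext hK
  rw [partialDeriv, h1, fderiv_comp y hh (Θ x).differentiableAt, ContinuousLinearMap.fderiv]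
  rfl

lemma partialDeriv_energyInChart_base
    (hK : ∀ᶠ u in 𝓝 x, ∀ v, energyInChart F φ u v = h (Θ u v)) (hΘ : HasFDerivAt Θ Θ' x)
    (hh : DifferentiableAt ℝ h (Θ x y)) (l : Fin n) :
    partialDeriv l (fun u => energyInChart F φ u y) x =
      fderiv ℝ h (Θ x y) (Θ' (EuclideanSpace.single l 1) y) := by
  have h1 : (fun u => energyInChart F φ u y) =ᶠ[𝓝 x] fun u => h (Θ u y) :=
    hK.mono fun u hu => hu y
  have h2 := hh.hasFDerivAt.comp x (hΘ.clm_apply (hasFDerivAt_const y x))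
  rw [partialDeriv, h1.fderiv_eq]
  refine (congrArg (fun T => T (EuclideanSpace.single l 1)) (HasFDerivAt.fderiv h2)).trans ?_
  simp

lemma fundamentalTensor_eq (hK : ∀ v, energyInChart F φ x v = h (Θ x v))
    (hh : ContDiffAt ℝ 2 h (Θ x y)) (i j : Fin n) :
    fundamentalTensor F φ x y i j = (1 / 2 : ℝ) * fderiv ℝ (fderiv ℝ h) (Θ x y)
      (Θ x (EuclideanSpace.single i 1)) (Θ x (EuclideanSpace.single j 1)) := by
  have h1 : (fun v => partialDeriv j (energyInChart F φ x) v) =ᶠ[𝓝 y]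
      fun v => fderiv ℝ h (Θ x v) (Θ x (EuclideanSpace.single j 1)) := by
    have h2 : ∀ᶠ v in 𝓝 y, ContDiffAt ℝ 2 h (Θ x v) :=
      (Θ x).continuous.continuousAt.eventually (hh.eventually (by simp))
    filter_upwards [h2] with v hv
    exact partialDeriv_energyInChart hK (hv.differentiableAt two_ne_zero) j
  have h3 : DifferentiableAt ℝ (fderiv ℝ h) (Θ x y) :=
    (hh.fderiv_right (m := 1) (by norm_num)).differentiableAt one_ne_zero
  have h4 := (h3.hasFDerivAt.comp y (Θ x).hasFDerivAt).clm_apply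
    (hasFDerivAt_const (Θ x (EuclideanSpace.single j 1)) y)
  rw [fundamentalTensor, Matrix.of_apply, partialDeriv, h1.fderiv_eq]
  congr 1
  refine (congrArg (fun T => T (EuclideanSpace.single i 1)) (HasFDerivAt.fderiv h4)).trans ?_
  simp

/-- Two terms arise because both the point `Θ u y` and the direction `Θ u eₗ` move with `u`. -/
lemma partialDeriv_partialDeriv_energyInChart
    (hK : ∀ᶠ u in 𝓝 x, ∀ v, energyInChart F φ u v = h (Θ u v)) (hΘ : HasFDerivAt Θ Θ' x)
    (hh : ContDiffAt ℝ 2 h (Θ x y)) (k l : Fin n) :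
    partialDeriv k (fun u => partialDeriv l (energyInChart F φ u) y) x =
      fderiv ℝ (fderiv ℝ h) (Θ x y) (Θ' (EuclideanSpace.single k 1) y)
          (Θ x (EuclideanSpace.single l 1)) +
        fderiv ℝ h (Θ x y) (Θ' (EuclideanSpace.single k 1) (EuclideanSpace.single l 1)) := by
  have h5 := hΘ.clm_apply (hasFDerivAt_const y x)
  have h6 := hΘ.clm_apply (hasFDerivAt_const (EuclideanSpace.single l (1 : ℝ)) x)
  have h1 : (fun u => partialDeriv l (energyInChart F φ u) y) =ᶠ[𝓝 x]
      fun u => fderiv ℝ h (Θ u y) (Θ u (EuclideanSpace.single l 1)) := by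
    have h2 : ∀ᶠ u in 𝓝 x, ContDiffAt ℝ 2 h (Θ u y) :=
      h5.continuousAt.eventually (hh.eventually (by simp))
    filter_upwards [h2, hK] with u hu hKu
    exact partialDeriv_energyInChart hKu (hu.differentiableAt two_ne_zero) l
  have h3 : DifferentiableAt ℝ (fderiv ℝ h) (Θ x y) :=
    (hh.fderiv_right (m := 1) (by norm_num)).differentiableAt one_ne_zero
  have h4 := (h3.hasFDerivAt.comp x h5).clm_apply h6
  rw [partialDeriv, h1.fderiv_eq]
  refine (congrArg (fun T => T (EuclideanSpace.single k 1)) (HasFDerivAt.fderiv h4)).trans ?_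
  simp [add_comm]

/-- A vector of `ℝⁿ` is the combination of the standard basis with its coordinates. -/
lemma sum_smul_single (z : EuclideanSpace ℝ (Fin n)) :
    ∑ i, z i • EuclideanSpace.single i (1 : ℝ) = z := by
  ext j
  simp [Finset.sum_apply, Pi.single_apply]

/-- Contraction with `yᵐ` turns `Θ' eₘ` into `Θ' y`. The base derivative then combines with the
second mixed term into the antisymmetric part of `Θ'`, where the Lie bracket will enter. -/
lemma sprayCoeff_eq (hK : ∀ᶠ u in 𝓝 x, ∀ v, energyInChart F φ u v = h (Θ u v))
    (hΘ : HasFDerivAt Θ Θ' x) (hh : ContDiffAt ℝ 2 h (Θ x y)) (i : Fin n) :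
    sprayCoeff F φ x y i = (1 / 4 : ℝ) * ∑ l, (fundamentalTensor F φ x y)⁻¹ i l *
      (fderiv ℝ (fderiv ℝ h) (Θ x y) (Θ' y y) (Θ x (EuclideanSpace.single l 1)) +
        fderiv ℝ h (Θ x y) (Θ' y (EuclideanSpace.single l 1) -
          Θ' (EuclideanSpace.single l 1) y)) := by
  rw [sprayCoeff]
  congr 1
  refine Finset.sum_congr rfl fun l _ => ?_
  congr 1
  rw [partialDeriv_energyInChart_base hK hΘ (hh.differentiableAt two_ne_zero)]
  simp only [partialDeriv_partialDeriv_energyInChart hK hΘ hh]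
  have h1 : ∀ A : EuclideanSpace ℝ (Fin n) →L[ℝ] ℝ,
      ∑ m, A (EuclideanSpace.single m 1) * y m = A y := by
    intro A
    conv_rhs => rw [← sum_smul_single y, map_sum]
    simp [mul_comm]
  have h2 := h1 (((fderiv ℝ (fderiv ℝ h) (Θ x y)).flip (Θ x (EuclideanSpace.single l 1))).comp
      (Θ'.flip y) + (fderiv ℝ h (Θ x y)).comp (Θ'.flip (EuclideanSpace.single l 1)))
  simp only [_root_.add_apply, ContinuousLinearMap.comp_apply, ContinuousLinearMap.flip_apply]
    at h2
  rw [h2, map_sub]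
  ring

/-- The matrix represents half the Hessian of `h` pulled back by the injective map `Θ x`, so a
kernel vector would have zero quadratic form. -/
lemma isUnit_det_fundamentalTensor (hK : ∀ v, energyInChart F φ x v = h (Θ x v))
    (hh : ContDiffAt ℝ 2 h (Θ x y)) (hΘ0 : ∀ v, Θ x v = 0 → v = 0)
    (hp : ∀ u, u ≠ 0 → 0 < fderiv ℝ (fderiv ℝ h) (Θ x y) u u) :
    IsUnit (fundamentalTensor F φ x y).det := by
  rw [← Matrix.isUnit_iff_isUnit_det]
  refine Matrix.vecMul_injective_iff_isUnit.1 ?_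
  rw [← Matrix.coe_vecMulLinear, injective_iff_map_eq_zero]
  intro v hv
  set z : EuclideanSpace ℝ (Fin n) := WithLp.toLp 2 v
  by_contra hne
  have hz : Θ x z ≠ 0 := fun h0 => hne (by
    have := hΘ0 z h0
    ext i
    simpa [z] using congrArg (fun u : EuclideanSpace ℝ (Fin n) => u i) this)
  have h1 : ∑ j, (∑ i, v i * fundamentalTensor F φ x y i j) * v j = 0 := by
    refine Finset.sum_eq_zero fun j _ => ?_
    have := congrFun hv j
    simp only [Matrix.coe_vecMulLinear, Matrix.vecMul, dotProduct, Pi.zero_apply] at this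
    rw [this, zero_mul]
  have h2 : ∑ j, (∑ i, v i * fundamentalTensor F φ x y i j) * v j =
      (1 / 2 : ℝ) * fderiv ℝ (fderiv ℝ h) (Θ x y) (Θ x z) (Θ x z) := by
    conv_rhs => rw [← sum_smul_single z]
    simp only [map_sum, map_smul, _root_.sum_apply, _root_.smul_apply,
      fundamentalTensor_eq hK hh, Finset.sum_mul, Finset.mul_sum, smul_eq_mul]
    refine Finset.sum_congr rfl fun j _ => Finset.sum_congr rfl fun i _ => ?_
    simp only [z]
    ring
  have := hp _ hz
  rw [h1] at h2
  linarith

/-- The spray `2 G` in a chart in which `F² = h (Θ x y)`. -/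
lemma fderiv_fderiv_spray (hK : ∀ᶠ u in 𝓝 x, ∀ v, energyInChart F φ u v = h (Θ u v))
    (hΘ : HasFDerivAt Θ Θ' x) (hh : ContDiffAt ℝ 2 h (Θ x y)) (hΘ0 : ∀ v, Θ x v = 0 → v = 0)
    (hp : ∀ u, u ≠ 0 → 0 < fderiv ℝ (fderiv ℝ h) (Θ x y) u u)
    {S : EuclideanSpace ℝ (Fin n)} (hS : ∀ i, S i = 2 * sprayCoeff F φ x y i)
    (z : EuclideanSpace ℝ (Fin n)) :
    fderiv ℝ (fderiv ℝ h) (Θ x y) (Θ x S) (Θ x z) =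
      fderiv ℝ (fderiv ℝ h) (Θ x y) (Θ' y y) (Θ x z) +
        fderiv ℝ h (Θ x y) (Θ' y z - Θ' z y) := by
  have hK' := hK.self_of_nhds
  have hu := isUnit_det_fundamentalTensor hK' hh hΘ0 hp
  have hsymm : ∀ u v, fderiv ℝ (fderiv ℝ h) (Θ x y) u v = fderiv ℝ (fderiv ℝ h) (Θ x y) v u :=
    (hh.isSymmSndFDerivAt (by simp)).eq
  suffices H : ∀ j, fderiv ℝ (fderiv ℝ h) (Θ x y) (Θ x S) (Θ x (EuclideanSpace.single j 1)) =
      fderiv ℝ (fderiv ℝ h) (Θ x y) (Θ' y y) (Θ x (EuclideanSpace.single j 1)) +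
        fderiv ℝ h (Θ x y)
          (Θ' y (EuclideanSpace.single j 1) - Θ' (EuclideanSpace.single j 1) y) by
    rw [← sum_smul_single z]
    simp only [map_sum, map_smul, _root_.sum_apply, _root_.smul_apply, H, ← Finset.sum_sub_distrib,
      ← smul_sub, ← Finset.sum_add_distrib, ← smul_add]
  intro j
  set R : Fin n → ℝ := fun l =>
    fderiv ℝ (fderiv ℝ h) (Θ x y) (Θ' y y) (Θ x (EuclideanSpace.single l 1)) +
        fderiv ℝ h (Θ x y)
          (Θ' y (EuclideanSpace.single l 1) - Θ' (EuclideanSpace.single l 1) y) with hR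
  have h1 : ∀ i, S i = (1 / 2 : ℝ) * ((fundamentalTensor F φ x y)⁻¹.mulVec R) i := by
    intro i
    rw [hS, sprayCoeff_eq hK hΘ hh, Matrix.mulVec, dotProduct]
    ring
  -- Multiplying by the fundamental tensor removes its inverse; read as half a Hessian, this is the
  -- claim on basis vectors.
  have h2 : (fundamentalTensor F φ x y).mulVec S = (1 / 2 : ℝ) • R := by
    have : (S : Fin n → ℝ) = (1 / 2 : ℝ) • ((fundamentalTensor F φ x y)⁻¹.mulVec R) :=
      funext h1
    rw [this, Matrix.mulVec_smul, Matrix.mulVec_mulVec, Matrix.mul_nonsing_inv _ hu,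
      Matrix.one_mulVec]
  have h3 := congrFun h2 j
  simp only [Matrix.mulVec, dotProduct, fundamentalTensor_eq hK' hh, Pi.smul_apply,
    smul_eq_mul] at h3
  conv_lhs => rw [← sum_smul_single S]
  simp only [map_sum, map_smul, _root_.sum_apply, _root_.smul_apply, smul_eq_mul]
  rw [← mul_right_inj' (show (1 / 2 : ℝ) ≠ 0 by norm_num)]
  refine Eq.trans ?_ h3
  rw [Finset.mul_sum]
  refine Finset.sum_congr rfl fun i _ => ?_
  rw [hsymm (Θ x (EuclideanSpace.single j 1))]
  ring

end Spray

/-! ### Left-invariant frames and the Maurer-Cartan form in a chart. -/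

section LeftFrame

open VectorField Filter Topology

lemma mlieBracket_eq_lieBracket {E : Type*} [NormedAddCommGroup E] [NormedSpace ℝ E]
    (V W : Π x : E, TangentSpace 𝓘(ℝ, E) x) (x : E) :
    mlieBracket 𝓘(ℝ, E) V W x = lieBracket ℝ V W x := by
  rw [← mlieBracketWithin_univ, mlieBracketWithin_eq_lieBracketWithin]
  exact congrFun lieBracketWithin_univ x

lemma mdifferentiable_of_mem_maximalAtlas {n : ℕ} {M : Type*} [TopologicalSpace M]
    [ChartedSpace (EuclideanSpace ℝ (Fin n)) M]
    {φ : OpenPartialHomeomorph M (EuclideanSpace ℝ (Fin n))}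
    (hφ : φ ∈ IsManifold.maximalAtlas (𝓡 n) ∞ M) :
    φ.MDifferentiable (𝓡 n) (𝓡 n) :=
  ⟨(contMDiffOn_of_mem_maximalAtlas hφ).mdifferentiableOn (by simp),
    (contMDiffOn_symm_of_mem_maximalAtlas hφ).mdifferentiableOn (by simp)⟩

lemma isInvertible_mfderiv_symm {n : ℕ} {M : Type*} [TopologicalSpace M]
    [ChartedSpace (EuclideanSpace ℝ (Fin n)) M]
    {φ : OpenPartialHomeomorph M (EuclideanSpace ℝ (Fin n))} {x : EuclideanSpace ℝ (Fin n)}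
    (hφ : φ ∈ IsManifold.maximalAtlas (𝓡 n) ∞ M)
    (hx : x ∈ φ.target) : (mfderiv (𝓡 n) (𝓡 n) φ.symm x).IsInvertible :=
  ⟨(mdifferentiable_of_mem_maximalAtlas hφ).symm.mfderiv hx, rfl⟩

variable {n : ℕ} {G : Type*} [TopologicalSpace G] [ChartedSpace (EuclideanSpace ℝ (Fin n)) G]
  [Group G]

variable (G) in
/-- The Lie bracket of `GroupLieAlgebra (𝓡 n) G` on the underlying space `ℝⁿ`. -/
def groupBracket (v w : EuclideanSpace ℝ (Fin n)) : EuclideanSpace ℝ (Fin n) :=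
  mlieBracket (𝓡 n) (mulInvariantVectorField (I := 𝓡 n) (G := G) v)
    (mulInvariantVectorField (I := 𝓡 n) (G := G) w) (1 : G)

/-- The coordinates in the chart `φ` of the left-invariant vector fields. -/
def leftFrame (φ : OpenPartialHomeomorph G (EuclideanSpace ℝ (Fin n)))
    (x : EuclideanSpace ℝ (Fin n)) : EuclideanSpace ℝ (Fin n) →L[ℝ] EuclideanSpace ℝ (Fin n) :=
  (mfderiv (𝓡 n) (𝓡 n) φ.symm x).inverse ∘L
    (mfderiv (𝓡 n) (𝓡 n) (fun q : G => φ.symm x * q) 1)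

/-- The left Maurer-Cartan form in the chart `φ`. -/
def leftCoframe (φ : OpenPartialHomeomorph G (EuclideanSpace ℝ (Fin n)))
    (x : EuclideanSpace ℝ (Fin n)) : EuclideanSpace ℝ (Fin n) →L[ℝ] EuclideanSpace ℝ (Fin n) :=
  (leftFrame φ x).inverse

variable {φ : OpenPartialHomeomorph G (EuclideanSpace ℝ (Fin n))}
  {x : EuclideanSpace ℝ (Fin n)}

lemma hasDerivAt_comp_of_isMIntegralCurve (hφ : φ ∈ IsManifold.maximalAtlas (𝓡 n) ∞ G)
    {Y : GroupLieAlgebra (𝓡 n) G} {γ : ℝ → G}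
    (hγ : IsMIntegralCurve (I := 𝓡 n) γ (mulInvariantVectorField (I := 𝓡 n) Y)) {t : ℝ}
    (ht : γ t ∈ φ.source) : HasDerivAt (φ ∘ γ) (leftFrame φ (φ (γ t)) Y) t := by
  have hφd := mdifferentiable_of_mem_maximalAtlas hφ
  have h1 := (hφd.mdifferentiableAt ht).hasMFDerivAt.comp t (hγ t)
  have h3 : mfderiv (𝓡 n) (𝓡 n) φ (γ t) (mulInvariantVectorField (I := 𝓡 n) Y (γ t)) =
      leftFrame φ (φ (γ t)) Y := by
    refine ((isInvertible_mfderiv_symm hφ (φ.map_source ht)).inverse_apply_eq.2 ?_).symm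
    -- `φ.symm (φ (γ t))` equals `γ t` only propositionally, so vectors are compared in the common
    -- model space `ℝⁿ`.
    have h4 : ∀ q : G, q = γ t → (mulInvariantVectorField (I := 𝓡 n) Y q :
        EuclideanSpace ℝ (Fin n)) = mulInvariantVectorField (I := 𝓡 n) Y (γ t) := by
      rintro _ rfl
      rfl
    refine (h4 _ (φ.left_inv ht)).trans ?_
    exact (congrArg (fun T => T (mulInvariantVectorField (I := 𝓡 n) Y (γ t)))
      (hφd.symm_comp_deriv ht)).symm
  rw [hasDerivAt_iff_hasFDerivAt, ← h3]
  refine (hasMFDerivAt_iff_hasFDerivAt.1 h1).congr_fderiv ?_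
  ext
  simp only
  exact map_smul (mfderiv (𝓡 n) (𝓡 n) φ (γ t)) (1 : ℝ) _

variable [LieGroup (𝓡 n) ∞ G]

/-- The scalar product at the identity on the underlying space `ℝⁿ`. -/
def innerOne (m : RiemMetric n G) :
    EuclideanSpace ℝ (Fin n) →L[ℝ] EuclideanSpace ℝ (Fin n) →L[ℝ] ℝ :=
  m.inner 1

lemma lieGroup_minSmoothness : LieGroup (𝓡 n) (minSmoothness ℝ 3) G :=
  LieGroup.of_le (n := ∞) (by rw [minSmoothness_of_isRCLikeNormedField]; norm_cast)

lemma isInvertible_mfderiv_mul_left (p q : G) :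
    (mfderiv (𝓡 n) (𝓡 n) (fun r : G => p * r) q).IsInvertible := by
  have hd : ∀ p q : G, MDifferentiableAt (𝓡 n) (𝓡 n) (fun r : G => p * r) q := fun p q =>
    (contMDiff_mul_left (I := 𝓡 n) (n := ∞)).contMDiffAt.mdifferentiableAt (by simp)
  have h1 : ∀ p q : G, mfderiv (𝓡 n) (𝓡 n) (fun r : G => p⁻¹ * r) (p * q) ∘L
      mfderiv (𝓡 n) (𝓡 n) (fun r : G => p * r) q = ContinuousLinearMap.id ℝ _ := by
    intro p q
    have h2 : (fun r => p⁻¹ * r) ∘ (fun r => p * r) = (id : G → G) := by ext r; simp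
    rw [← mfderiv_comp (I' := 𝓡 n) q (hd _ _) (hd _ _), h2, mfderiv_id]
  refine ContinuousLinearMap.IsInvertible.of_inverse
    (g := mfderiv (𝓡 n) (𝓡 n) (fun r : G => p⁻¹ * r) (p * q)) ?_ (h1 p q)
  -- The other composite is the same identity for `p⁻¹` at `p * q`.
  have h3 := h1 p⁻¹ (p * q)
  rw [inv_inv, inv_mul_cancel_left] at h3
  exact h3

lemma isInvertible_leftFrame (hφ : φ ∈ IsManifold.maximalAtlas (𝓡 n) ∞ G)
    (hx : x ∈ φ.target) : (leftFrame φ x).IsInvertible := by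
  refine ContinuousLinearMap.IsInvertible.comp ?_ (isInvertible_mfderiv_mul_left _ _)
  obtain ⟨e, he⟩ := isInvertible_mfderiv_symm hφ hx
  exact ⟨e.symm, by rw [← he, ContinuousLinearMap.inverse_equiv]; rfl⟩

lemma leftFrame_leftCoframe (hφ : φ ∈ IsManifold.maximalAtlas (𝓡 n) ∞ G)
    (hx : x ∈ φ.target) (y : EuclideanSpace ℝ (Fin n)) :
    leftFrame φ x (leftCoframe φ x y) = y :=
  (isInvertible_leftFrame hφ hx).self_apply_inverse y

lemma leftCoframe_leftFrame (hφ : φ ∈ IsManifold.maximalAtlas (𝓡 n) ∞ G)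
    (hx : x ∈ φ.target) (y : EuclideanSpace ℝ (Fin n)) :
    leftCoframe φ x (leftFrame φ x y) = y :=
  (isInvertible_leftFrame hφ hx).inverse_apply_self y

lemma mfderiv_symm_eq (hφ : φ ∈ IsManifold.maximalAtlas (𝓡 n) ∞ G)
    (hx : x ∈ φ.target) (y : EuclideanSpace ℝ (Fin n)) :
    mfderiv (𝓡 n) (𝓡 n) φ.symm x y =
      mfderiv (𝓡 n) (𝓡 n) (fun q : G => φ.symm x * q) 1 (leftCoframe φ x y) :=
  ((isInvertible_mfderiv_symm hφ hx).inverse_apply_eq.1 (leftFrame_leftCoframe hφ hx y)).symm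

lemma inner_mfderiv_mul_left {m : RiemMetric n G} (hm : IsLeftInvariant m) (p : G)
    (u v : EuclideanSpace ℝ (Fin n)) :
    m.inner p (mfderiv (𝓡 n) (𝓡 n) (fun q : G => p * q) 1 u)
      (mfderiv (𝓡 n) (𝓡 n) (fun q : G => p * q) 1 v) = innerOne m u v := by
  have h1 : ∀ q : G, q = p → ∀ u v : EuclideanSpace ℝ (Fin n), m.inner q u v = m.inner p u v := by
    rintro _ rfl u v
    rfl
  exact (h1 (p * 1) (mul_one p) _ _).symm.trans (hm p 1 u v)

/-- Left invariance of both the metric and the field moves every evaluation to the identity, leaving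
a norm independent of `x`. -/
lemma energyInChart_randers {m : RiemMetric n G} (hm : IsLeftInvariant m)
    (hφ : φ ∈ IsManifold.maximalAtlas (𝓡 n) ∞ G) (hx : x ∈ φ.target)
    (X : GroupLieAlgebra (𝓡 n) G) (y : EuclideanSpace ℝ (Fin n)) :
    energyInChart (randers m X) φ x y = randersNorm (innerOne m) X (leftCoframe φ x y) ^ 2 := by
  rw [energyInChart, randers, mfderiv_symm_eq hφ hx]
  exact congrArg (· ^ 2) (congrArg₂ (· + ·)
    (congrArg Real.sqrt (inner_mfderiv_mul_left hm _ _ _)) (inner_mfderiv_mul_left hm _ _ _))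

/-- This is the pullback by `φ.symm` of a left-invariant field; pulling back costs one derivative of
the map. -/
lemma contDiffAt_leftFrame_apply (hφ : φ ∈ IsManifold.maximalAtlas (𝓡 n) ∞ G)
    (hx : x ∈ φ.target) (w : EuclideanSpace ℝ (Fin n)) :
    ContDiffAt ℝ 1 (fun u => leftFrame φ u w) x := by
  have := lieGroup_minSmoothness (n := n) (G := G)
  have h1 : ContMDiffAt (𝓡 n) (𝓡 n).tangent 1 (fun g : G =>
      (⟨g, mulInvariantVectorField (I := 𝓡 n) (G := G) w g⟩ : TangentBundle (𝓡 n) G))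
      (φ.symm x) :=
    (contMDiffAt_mulInvariantVectorField (I := 𝓡 n) (G := G) w).of_le (by simp)
  have h2 : ContMDiffAt (𝓡 n) (𝓡 n) 2 φ.symm x :=
    (contMDiffAt_symm_of_mem_maximalAtlas hφ hx).of_le (by norm_cast)
  exact contMDiffAt_vectorSpace_iff_contDiffAt.1
    (h1.mpullback_vectorField_preimage h2 (isInvertible_mfderiv_symm hφ hx) (by norm_num))

lemma contDiffAt_leftFrame (hφ : φ ∈ IsManifold.maximalAtlas (𝓡 n) ∞ G)
    (hx : x ∈ φ.target) : ContDiffAt ℝ 1 (leftFrame φ) x := by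
  have h1 : ContDiffOn ℝ 1 (leftFrame φ) φ.target :=
    contDiffOn_clm_apply.2 fun w u hu =>
      (contDiffAt_leftFrame_apply hφ hu w).contDiffWithinAt
  exact h1.contDiffAt (φ.open_target.mem_nhds hx)

lemma differentiableAt_leftCoframe (hφ : φ ∈ IsManifold.maximalAtlas (𝓡 n) ∞ G)
    (hx : x ∈ φ.target) : DifferentiableAt ℝ (leftCoframe φ) x :=
  ((isInvertible_leftFrame hφ hx).contDiffAt_map_inverse.comp x
    (contDiffAt_leftFrame hφ hx)).differentiableAt one_ne_zero

/-- Pullback commutes with brackets, and the bracket of left-invariant fields is left-invariant. -/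
lemma lieBracket_leftFrame (hφ : φ ∈ IsManifold.maximalAtlas (𝓡 n) ∞ G)
    (hx : x ∈ φ.target) (v w : EuclideanSpace ℝ (Fin n)) :
    lieBracket ℝ (fun u => leftFrame φ u v) (fun u => leftFrame φ u w) x =
      leftFrame φ x (groupBracket G v w) := by
  have := lieGroup_minSmoothness (n := n) (G := G)
  have h2 : ContMDiffAt (𝓡 n) (𝓡 n) 2 φ.symm x :=
    (contMDiffAt_symm_of_mem_maximalAtlas hφ hx).of_le (by norm_cast)
  have h3 := mpullback_mlieBracket (I := 𝓡 n) (I' := 𝓡 n) (n := 2) (f := φ.symm) (x₀ := x)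
    (mdifferentiableAt_mulInvariantVectorField (I := 𝓡 n) (G := G) v)
    (mdifferentiableAt_mulInvariantVectorField (I := 𝓡 n) (G := G) w) h2 (by simp)
  have h4 : mpullback (𝓡 n) (𝓡 n) φ.symm (mulInvariantVectorField (I := 𝓡 n) (G := G)
      (groupBracket G v w)) x = lieBracket ℝ (fun u => leftFrame φ u v)
        (fun u => leftFrame φ u w) x := by
    refine Eq.trans ?_ (h3.trans (mlieBracket_eq_lieBracket _ _ x))
    exact congrArg (fun V => mpullback (𝓡 n) (𝓡 n) φ.symm V x)
      (mulInvariantVector_mlieBracket (I := 𝓡 n) (G := G) v w)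
  exact h4.symm

/-- The derivative of the left Maurer-Cartan form. -/
lemma fderiv_leftCoframe_apply (hφ : φ ∈ IsManifold.maximalAtlas (𝓡 n) ∞ G)
    (hx : x ∈ φ.target) (y w : EuclideanSpace ℝ (Fin n)) :
    fderiv ℝ (leftCoframe φ) x y (leftFrame φ x w) =
      -leftCoframe φ x (fderiv ℝ (fun u => leftFrame φ u w) x y) := by
  have h1 : (fun u => leftCoframe φ u (leftFrame φ u w)) =ᶠ[𝓝 x] fun _ => w := by
    filter_upwards [φ.open_target.mem_nhds hx] with u hu using leftCoframe_leftFrame hφ hu w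
  have h2 := (differentiableAt_leftCoframe hφ hx).hasFDerivAt.clm_apply
    ((contDiffAt_leftFrame_apply hφ hx w).differentiableAt one_ne_zero).hasFDerivAt
  have h3 := congrArg (fun T => T y) (h2.unique ((hasFDerivAt_const w x).congr_of_eventuallyEq h1))
  simp only [_root_.add_apply, ContinuousLinearMap.comp_apply, ContinuousLinearMap.flip_apply,
    _root_.zero_apply] at h3
  exact eq_neg_of_add_eq_zero_right h3

/-- The Maurer-Cartan equation. -/
lemma fderiv_leftCoframe_sub (hφ : φ ∈ IsManifold.maximalAtlas (𝓡 n) ∞ G)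
    (hx : x ∈ φ.target) (y z : EuclideanSpace ℝ (Fin n)) :
    fderiv ℝ (leftCoframe φ) x y z - fderiv ℝ (leftCoframe φ) x z y =
      -groupBracket G (leftCoframe φ x y) (leftCoframe φ x z) := by
  -- `y` and `z` are extended to left-invariant fields, on which `Θ` is constant. Derivatives of `Θ`
  -- become derivatives of these fields, and the difference is their bracket.
  have h1 := fderiv_leftCoframe_apply hφ hx y (leftCoframe φ x z)
  have h2 := fderiv_leftCoframe_apply hφ hx z (leftCoframe φ x y)
  have h3 := lieBracket_leftFrame hφ hx (leftCoframe φ x y) (leftCoframe φ x z)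
  simp only [lieBracket, leftFrame_leftCoframe hφ hx] at h1 h2 h3
  rw [h1, h2, ← leftCoframe_leftFrame hφ hx (groupBracket G _ _), ← h3, map_sub]
  abel

end LeftFrame

/-! ### The geodesic equation along one-parameter subgroups. -/

section GeodesicVectors

open VectorField Filter Topology

variable {n : ℕ} {G : Type*} [TopologicalSpace G] [ChartedSpace (EuclideanSpace ℝ (Fin n)) G]
  [Group G] [LieGroup (𝓡 n) ∞ G]

lemma groupBracket_self (w : EuclideanSpace ℝ (Fin n)) : groupBracket G w w = 0 := by
  have := lieGroup_minSmoothness (n := n) (G := G)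
  exact lie_self (L := GroupLieAlgebra (𝓡 n) G) w

lemma groupBracket_neg_left (v w : EuclideanSpace ℝ (Fin n)) :
    groupBracket G (-v) w = -groupBracket G v w := by
  have := lieGroup_minSmoothness (n := n) (G := G)
  exact neg_lie (L := GroupLieAlgebra (𝓡 n) G) (M := GroupLieAlgebra (𝓡 n) G) v w

lemma innerOne_symm (m : RiemMetric n G) (u v : EuclideanSpace ℝ (Fin n)) :
    innerOne m u v = innerOne m v u := m.symm 1 u v

lemma innerOne_pos (m : RiemMetric n G) (u : EuclideanSpace ℝ (Fin n)) (hu : u ≠ 0) :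
    0 < innerOne m u u := m.pos 1 u hu

variable {φ : OpenPartialHomeomorph G (EuclideanSpace ℝ (Fin n))}
  {x : EuclideanSpace ℝ (Fin n)} {m : RiemMetric n G} {X : EuclideanSpace ℝ (Fin n)}

/-- The spray of a left-invariant Randers metric in terms of the Lie bracket. -/
lemma randersHessian_spray (hm : IsLeftInvariant m) (hX : Real.sqrt (innerOne m X X) < 1)
    (hφ : φ ∈ IsManifold.maximalAtlas (𝓡 n) ∞ G) (hx : x ∈ φ.target)
    {y w S : EuclideanSpace ℝ (Fin n)} (hw : w ≠ 0) (hy : y = leftFrame φ x w)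
    (hS : ∀ i, S i = 2 * sprayCoeff (randers m X) φ x y i) (z : EuclideanSpace ℝ (Fin n)) :
    randersHessian (innerOne m) X w (leftCoframe φ x S - fderiv ℝ (leftCoframe φ) x y y) z =
      -(2 * randersNorm (innerOne m) X w *
        randersNormDeriv (innerOne m) X w (groupBracket G w z)) := by
  have hs := innerOne_symm m
  have hp := innerOne_pos m
  have hΘy : leftCoframe φ x y = w := by rw [hy, leftCoframe_leftFrame hφ hx]
  have hK : ∀ᶠ u in 𝓝 x, ∀ v, energyInChart (randers m X) φ u v =
      (fun w => randersNorm (innerOne m) X w ^ 2) (leftCoframe φ u v) := by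
    filter_upwards [φ.open_target.mem_nhds hx] with u hu v using energyInChart_randers hm hφ hu X v
  have hh : ContDiffAt ℝ 2 (fun w => randersNorm (innerOne m) X w ^ 2) (leftCoframe φ x y) := by
    rw [hΘy]
    exact (contDiffAt_sq_randersNorm hp hw).of_le (by norm_cast)
  have hΘ0 : ∀ v, leftCoframe φ x v = 0 → v = 0 := fun v hv => by
    rw [← leftFrame_leftCoframe hφ hx v, hv, map_zero]
  have hpos : ∀ u, u ≠ 0 → 0 < fderiv ℝ (fderiv ℝ (fun w => randersNorm (innerOne m) X w ^ 2))
      (leftCoframe φ x y) u u := fun u hu => by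
    rw [hΘy, fderiv_fderiv_sq_randersNorm hs hp hw]
    exact randersHessian_pos hs hp hX hw hu
  have h1 := fderiv_fderiv_spray hK (differentiableAt_leftCoframe hφ hx).hasFDerivAt hh hΘ0 hpos hS
    (leftFrame φ x z)
  rw [fderiv_leftCoframe_sub hφ hx, leftCoframe_leftFrame hφ hx, hΘy,
    fderiv_sq_randersNorm hs hp hw] at h1
  rw [← fderiv_fderiv_sq_randersNorm hs hp hw, map_sub, _root_.sub_apply, h1]
  simp

lemma apply_deriv_deriv_of_apply_deriv_eq_const {E : Type*} [NormedAddCommGroup E]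
    [NormedSpace ℝ E] {Θ : E → E →L[ℝ] E} {c : ℝ → E} {t : ℝ} (Y : E)
    (hΘ : DifferentiableAt ℝ Θ (c t)) (hc : DifferentiableAt ℝ c t)
    (hc' : DifferentiableAt ℝ (deriv c) t) (h : ∀ᶠ s in 𝓝 t, Θ (c s) (deriv c s) = Y) :
    Θ (c t) (deriv (deriv c) t) = -fderiv ℝ Θ (c t) (deriv c t) (deriv c t) := by
  have h1 : HasDerivAt (fun s => Θ (c s)) (fderiv ℝ Θ (c t) (deriv c t)) t :=
    hΘ.hasFDerivAt.comp_hasDerivAt t hc.hasDerivAt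
  have h2 := h1.clm_apply hc'.hasDerivAt
  have h3 := h2.unique ((hasDerivAt_const t Y).congr_of_eventuallyEq h)
  exact eq_neg_of_add_eq_zero_right h3

lemma leftCoframe_deriv_deriv_comp (hφ : φ ∈ IsManifold.maximalAtlas (𝓡 n) ∞ G)
    {Y : EuclideanSpace ℝ (Fin n)} {γ : ℝ → G}
    (hγ : IsMIntegralCurve (I := 𝓡 n) γ (mulInvariantVectorField (I := 𝓡 n) Y)) {t : ℝ}
    (ht : γ t ∈ φ.source) :
    leftCoframe φ (φ (γ t)) (deriv (deriv (φ ∘ γ)) t) =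
        -fderiv ℝ (leftCoframe φ) (φ (γ t)) (leftFrame φ (φ (γ t)) Y)
          (leftFrame φ (φ (γ t)) Y) := by
  have hc : ∀ᶠ s in 𝓝 t, γ s ∈ φ.source :=
    (hγ t).continuousAt.eventually (φ.open_source.mem_nhds ht)
  have h0 := hasDerivAt_comp_of_isMIntegralCurve hφ hγ ht
  have h1 : deriv (φ ∘ γ) =ᶠ[𝓝 t] (fun u => leftFrame φ u Y) ∘ (φ ∘ γ) := by
    filter_upwards [hc] with s hs using (hasDerivAt_comp_of_isMIntegralCurve hφ hγ hs).deriv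
  have hx := φ.map_source ht
  have h2 : DifferentiableAt ℝ (deriv (φ ∘ γ)) t := by
    refine DifferentiableAt.congr_of_eventuallyEq ?_ h1
    exact DifferentiableAt.comp t
      ((contDiffAt_leftFrame_apply hφ hx Y).differentiableAt one_ne_zero) h0.differentiableAt
  rw [← h0.deriv]
  refine apply_deriv_deriv_of_apply_deriv_eq_const (c := φ ∘ γ) Y
    (differentiableAt_leftCoframe hφ hx) h0.differentiableAt h2 ?_
  filter_upwards [hc, h1] with s hs hs1
  rw [hs1]
  exact leftCoframe_leftFrame hφ (φ.map_source hs) Y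

/-- Bootstrap on `c' = leftFrame φ c Y`, whose right side is `C¹` in `c`: continuity gives `C¹`,
which gives `C²`. -/
lemma contMDiff_two_of_isMIntegralCurve {Y : EuclideanSpace ℝ (Fin n)} {γ : ℝ → G}
    (hγ : IsMIntegralCurve (I := 𝓡 n) γ (mulInvariantVectorField (I := 𝓡 n) Y)) :
    ContMDiff 𝓘(ℝ, ℝ) (𝓡 n) 2 γ := by
  intro t
  have hcont : Continuous γ := continuous_iff_continuousAt.2 fun t => (hγ t).continuousAt
  rw [contMDiffAt_iff_target]
  refine ⟨hcont.continuousAt, ?_⟩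
  set φ := chartAt (EuclideanSpace ℝ (Fin n)) (γ t)
  have hφ : φ ∈ IsManifold.maximalAtlas (𝓡 n) ∞ G := IsManifold.chart_mem_maximalAtlas _
  have hI : IsOpen (γ ⁻¹' φ.source) := φ.open_source.preimage hcont
  have hd : ∀ s ∈ γ ⁻¹' φ.source, HasDerivAt (φ ∘ γ) (leftFrame φ (φ (γ s)) Y) s :=
    fun s hs => hasDerivAt_comp_of_isMIntegralCurve hφ hγ hs
  have hdiff : DifferentiableOn ℝ (φ ∘ γ) (γ ⁻¹' φ.source) :=
    fun s hs => (hd s hs).differentiableAt.differentiableWithinAt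
  have hΛ : ContDiffOn ℝ 1 (fun u => leftFrame φ u Y) φ.target :=
    fun u hu => (contDiffAt_leftFrame_apply hφ hu Y).contDiffWithinAt
  have hmaps : Set.MapsTo (φ ∘ γ) (γ ⁻¹' φ.source) φ.target := fun s hs => φ.map_source hs
  have step : ∀ k : ℕ∞ω, k ≤ 1 → k ≠ ω → ContDiffOn ℝ k (φ ∘ γ) (γ ⁻¹' φ.source) →
      ContDiffOn ℝ (k + 1) (φ ∘ γ) (γ ⁻¹' φ.source) := by
    intro k hk hω h
    refine (contDiffOn_succ_iff_deriv_of_isOpen hI).2 ⟨hdiff, fun h' => absurd h' hω, ?_⟩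
    refine ((hΛ.of_le hk).comp h hmaps).congr fun s hs => (hd s hs).deriv
  have h0 : ContDiffOn ℝ 0 (φ ∘ γ) (γ ⁻¹' φ.source) := contDiffOn_zero.2 hdiff.continuousOn
  have h1 := step 0 (by simp) (by simp) h0
  rw [zero_add] at h1
  have h2 := step 1 le_rfl (by simp) h1
  rw [one_add_one_eq_two] at h2
  exact (h2.contDiffAt (hI.mem_nhds (mem_chart_source _ (γ t)))).contMDiffAt

/-- The geodesic equation of a left-invariant Randers metric along an integral curve of the
left-invariant vector field `Y`. -/
lemma geodesic_equation_iff (hm : IsLeftInvariant m) (hX : Real.sqrt (innerOne m X X) < 1)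
    (hφ : φ ∈ IsManifold.maximalAtlas (𝓡 n) ∞ G)
    {Y : EuclideanSpace ℝ (Fin n)} (hY : Y ≠ 0) {γ : ℝ → G}
    (hγ : IsMIntegralCurve (I := 𝓡 n) γ (mulInvariantVectorField (I := 𝓡 n) Y)) {t : ℝ}
    (ht : γ t ∈ φ.source) :
    (deriv (φ ∘ γ) t ≠ 0 ∧ ∀ i, deriv (deriv (φ ∘ γ)) t i +
      2 * sprayCoeff (randers m X) φ (φ (γ t)) (deriv (φ ∘ γ) t) i = 0) ↔
    ∀ z, randersNormDeriv (innerOne m) X Y (groupBracket G Y z) = 0 := by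
  have hs := innerOne_symm m
  have hp := innerOne_pos m
  have hx := φ.map_source ht
  have hd := (hasDerivAt_comp_of_isMIntegralCurve hφ hγ ht).deriv
  set y := leftFrame φ (φ (γ t)) Y with hy
  have hy0 : y ≠ 0 := fun h => hY (by
    have h' := leftCoframe_leftFrame hφ hx Y
    rw [← hy, h, map_zero] at h'
    exact h'.symm)
  set S : EuclideanSpace ℝ (Fin n) :=
    WithLp.toLp 2 fun i => 2 * sprayCoeff (randers m X) φ (φ (γ t)) y i with hS
  have hkey := randersHessian_spray hm hX hφ hx hY hy (S := S) (fun i => rfl)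
  have hacc := leftCoframe_deriv_deriv_comp hφ hγ ht
  rw [← hy] at hacc
  -- Since `Θ(c'') = -DΘ(y) y`, the vector governed by the spray identity is `Θ(c'' + S)`, which
  -- vanishes exactly when the geodesic equation holds.
  have hq : leftCoframe φ (φ (γ t)) (deriv (deriv (φ ∘ γ)) t + S) =
      leftCoframe φ (φ (γ t)) S - fderiv ℝ (leftCoframe φ) (φ (γ t)) y y := by
    rw [map_add, hacc]
    abel
  rw [← hq] at hkey
  have hN := randersNorm_pos hs hp hX hY
  rw [hd]
  constructor
  · rintro ⟨-, h⟩ z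
    have h0 : deriv (deriv (φ ∘ γ)) t + S = 0 := by
      ext i
      exact h i
    have h1 := hkey z
    rw [h0, map_zero] at h1
    have h2 : randersHessian (innerOne m) X Y 0 z = 0 := by simp [randersHessian]
    rw [h2, eq_comm, neg_eq_zero] at h1
    exact (mul_eq_zero.1 h1).resolve_left (by positivity)
  · intro h
    refine ⟨hy0, fun i => ?_⟩
    -- Positive definiteness, with this vector itself as the test vector `z`.
    have h1 : leftCoframe φ (φ (γ t)) (deriv (deriv (φ ∘ γ)) t + S) = 0 := by
      by_contra hne
      have h2 := randersHessian_pos hs hp hX hY hne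
      rw [hkey, h, mul_zero, neg_zero] at h2
      exact lt_irrefl _ h2
    have h2 : deriv (deriv (φ ∘ γ)) t + S = 0 := by
      rw [← leftFrame_leftCoframe hφ hx (deriv (deriv (φ ∘ γ)) t + S), h1, map_zero]
    exact congrArg (fun v : EuclideanSpace ℝ (Fin n) => v i) h2

end GeodesicVectors

/-! ### The Douglas condition, and completeness of left-invariant fields. -/

section Douglas

open VectorField Filter Topology

lemma randersHessian_comm {V : Type*} [NormedAddCommGroup V] [NormedSpace ℝ V]
    {B : V →L[ℝ] V →L[ℝ] ℝ} (hs : ∀ u v, B u v = B v u) (X w u v : V) :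
    randersHessian B X w u v = randersHessian B X w v u := by
  rw [randersHessian, randersHessian, hs u v]
  ring

/-- In the equation satisfied by the spray of a Randers metric, the component along `w` of the
spray can be eliminated. -/
lemma randersHessian_eq_elim {V : Type*} [NormedAddCommGroup V] [NormedSpace ℝ V]
    {B : V →L[ℝ] V →L[ℝ] ℝ} {X w q : V} {p : ℝ} {c : V → V}
    (hs : ∀ u v, B u v = B v u) (hp : ∀ u, u ≠ 0 → 0 < B u u)
    (hX : Real.sqrt (B X X) < 1) (hw : w ≠ 0) (hc : c w = 0)
    (h : ∀ z, randersHessian B X w (q + p • w) z =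
      -(2 * randersNorm B X w * randersNormDeriv B X w (c z))) (z : V) :
    B q z - B w q * B w z / B w w = -(B w (c z) + Real.sqrt (B w w) * B X (c z)) := by
  have hpos := hp w hw
  have hα := Real.sqrt_pos.2 hpos
  have hN := randersNorm_pos hs hp hX hw
  -- Test with `z = w`: as `c w = 0`, Euler's relation kills the rank-one term of the Hessian.
  have h1 : randersNormDeriv B X w (q + p • w) = 0 := by
    have h2 := h w
    rw [randersHessian_comm hs, randersHessian_self_left hp hw, hc, map_zero, mul_zero,
      neg_zero] at h2
    exact (mul_eq_zero.1 h2).resolve_left (by positivity)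
  have h3 := h z
  rw [randersHessian, h1] at h3
  simp only [randersNormDeriv, map_add, map_smul, _root_.add_apply, _root_.smul_apply,
    smul_eq_mul] at h3
  -- The angular form annihilates `w`, so `p` disappears.
  have h4 : B q z + p * B w z - (B w q + p * B w w) * B w z / B w w =
      B q z - B w q * B w z / B w w := by
    field_simp
    ring
  rw [h4] at h3
  generalize Real.sqrt (B w w) = α at *
  generalize randersNorm B X w = N at *
  generalize B q z - B w q * B w z / B w w = L at *
  field_simp at h3
  rw [zero_mul, zero_add] at h3
  exact mul_left_cancel₀ hN.ne' (by linarith)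

variable {n : ℕ} {G : Type*} [TopologicalSpace G] [ChartedSpace (EuclideanSpace ℝ (Fin n)) G]
  [Group G] [LieGroup (𝓡 n) ∞ G] {m : RiemMetric n G} {X : EuclideanSpace ℝ (Fin n)}

/-- If a left-invariant Randers metric is of Douglas type, then `X` is orthogonal to the derived
algebra. -/
lemma IsDouglas.innerOne_groupBracket_eq_zero (hm : IsLeftInvariant m)
    (hX : Real.sqrt (innerOne m X X) < 1) (hD : IsDouglas (randers m X))
    (w z : EuclideanSpace ℝ (Fin n)) : innerOne m X (groupBracket G w z) = 0 := by
  have hs := innerOne_symm m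
  have hp := innerOne_pos m
  rcases eq_or_ne w 0 with rfl | hw
  · have h0 := groupBracket_neg_left (G := G) 0 z
    rw [neg_zero, eq_neg_iff_add_eq_zero, ← two_smul ℝ, smul_eq_zero] at h0
    rw [h0.resolve_left two_ne_zero, map_zero]
  set φ := chartAt (EuclideanSpace ℝ (Fin n)) (1 : G)
  have hφ : φ ∈ IsManifold.maximalAtlas (𝓡 n) ∞ G := IsManifold.chart_mem_maximalAtlas _
  set x := φ 1
  have hx : x ∈ φ.target := φ.map_source (mem_chart_source _ _)
  obtain ⟨Γ, P, -, hΓ⟩ := hD φ hφ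
  set Q : EuclideanSpace ℝ (Fin n) → EuclideanSpace ℝ (Fin n) := fun y =>
    WithLp.toLp 2 fun i => ∑ j, ∑ k, Γ x i j k * y j * y k with hQ
  set q : EuclideanSpace ℝ (Fin n) → EuclideanSpace ℝ (Fin n) := fun w =>
    leftCoframe φ x (Q (leftFrame φ x w)) -
      fderiv ℝ (leftCoframe φ) x (leftFrame φ x w) (leftFrame φ x w) with hq
  -- Both parts of `q` are quadratic in `w`.
  have hqneg : q (-w) = q w := by
    simp only [hq, hQ, map_neg, _root_.neg_apply, neg_neg, PiLp.neg_apply, mul_neg, neg_mul]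
  have key : ∀ w, w ≠ 0 → innerOne m (q w) z - innerOne m w (q w) * innerOne m w z /
      innerOne m w w = -(innerOne m w (groupBracket G w z) +
        Real.sqrt (innerOne m w w) * innerOne m X (groupBracket G w z)) := by
    intro w hw
    set y := leftFrame φ x w with hy
    have hy0 : y ≠ 0 := fun h => hw (by
      rw [← leftCoframe_leftFrame hφ hx w, ← hy, h, map_zero])
    have hS : ∀ i, (Q y + (2 * P x y) • y) i = 2 * sprayCoeff (randers m X) φ x y i := by
      intro i
      rw [hΓ x hx y hy0 i, hQ]
      simp only [PiLp.add_apply, PiLp.smul_apply, smul_eq_mul]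
      ring
    refine randersHessian_eq_elim (p := 2 * P x y) (c := fun z => groupBracket G w z) hs hp hX hw
      (groupBracket_self w) (fun z => ?_) z
    rw [← randersHessian_spray hm hX hφ hx hw hy hS z]
    congr 1
    simp only [hq, map_add, map_smul, ← hy]
    rw [hy, leftCoframe_leftFrame hφ hx]
    abel
  -- The left side of `key` and `B(w, [w, z])` are even in `w`, so comparing `w` with `-w` isolates
  -- the term containing `X`.
  have h1 := key w hw
  have h2 := key (-w) (neg_ne_zero.2 hw)
  rw [hqneg, groupBracket_neg_left] at h2
  simp only [map_neg, _root_.neg_apply, neg_neg, mul_neg, neg_mul] at h2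
  have h3 : Real.sqrt (innerOne m w w) * innerOne m X (groupBracket G w z) = 0 := by linarith
  exact (mul_eq_zero.1 h3).resolve_left (Real.sqrt_pos.2 (hp w hw)).ne'

/-- Left-invariant vector fields are complete. -/
lemma exists_isMIntegralCurve_mulInvariantVectorField (Y : EuclideanSpace ℝ (Fin n)) :
    ∃ γ : ℝ → G, γ 0 = 1 ∧
      IsMIntegralCurve (I := 𝓡 n) γ (mulInvariantVectorField (I := 𝓡 n) Y) := by
  have := lieGroup_minSmoothness (n := n) (G := G)
  have := topologicalGroup_of_lieGroup (𝓡 n) ∞ (G := G)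
  have : T1Space G := ChartedSpace.t1Space (EuclideanSpace ℝ (Fin n)) G
  have hv : ContMDiff (𝓡 n) (𝓡 n).tangent 1 (fun g : G =>
      (⟨g, mulInvariantVectorField (I := 𝓡 n) (G := G) Y g⟩ : TangentBundle (𝓡 n) G)) :=
    (contMDiff_mulInvariantVectorField (I := 𝓡 n) (G := G) Y).of_le (by simp)
  obtain ⟨γ, hγ0, hγ⟩ := exists_isMIntegralCurveAt_of_contMDiffAt_boundaryless 0
    (hv.contMDiffAt (x := (1 : G)))
  obtain ⟨ε, hε, hγ⟩ := isMIntegralCurveAt_iff'.1 hγ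
  -- One time `ε` serves every starting point: the local curve through `1` is translated on the left
  -- by `p`.
  refine exists_isMIntegralCurve_of_isMIntegralCurveOn hv hε (fun p => ?_) 1
  refine ⟨fun t => p * γ t, by simp [hγ0], ?_⟩
  intro t ht
  rw [Real.ball_eq_Ioo, zero_sub, zero_add] at hγ
  have hd : ∀ p q : G, MDifferentiableAt (𝓡 n) (𝓡 n) (fun r : G => p * r) q := fun p q =>
    (contMDiff_mul_left (I := 𝓡 n) (n := ∞)).contMDiffAt.mdifferentiableAt (by simp)
  have h1 := (hd p (γ t)).hasMFDerivAt.comp_hasMFDerivWithinAt t (hγ t ht)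
  have h2 : mfderiv (𝓡 n) (𝓡 n) (fun r : G => p * r) (γ t)
      (mulInvariantVectorField (I := 𝓡 n) Y (γ t)) =
        mulInvariantVectorField (I := 𝓡 n) Y (p * γ t) := by
    have h3 : (fun r : G => p * γ t * r) = (fun r : G => p * r) ∘ fun r => γ t * r := by
      ext r
      simp [mul_assoc]
    have h4 : ∀ q : G, q = γ t → ∀ v : EuclideanSpace ℝ (Fin n),
        (mfderiv (𝓡 n) (𝓡 n) (fun r : G => p * r) q v : EuclideanSpace ℝ (Fin n)) =
          mfderiv (𝓡 n) (𝓡 n) (fun r : G => p * r) (γ t) v := by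
      rintro _ rfl v
      rfl
    have h5 := mfderiv_comp (I := 𝓡 n) (I' := 𝓡 n) (I'' := 𝓡 n) (1 : G) (hd p (γ t * 1))
      (hd (γ t) 1)
    rw [← h3] at h5
    refine Eq.symm ((congrArg (fun T => T Y) h5).trans ?_)
    exact h4 (γ t * 1) (mul_one _) _
  refine HasMFDerivWithinAt.congr_mfderiv h1 ?_
  ext
  refine (map_smul (mfderiv (𝓡 n) (𝓡 n) (fun r : G => p * r) (γ t)) (1 : ℝ) _).trans ?_
  exact congrArg (fun v : EuclideanSpace ℝ (Fin n) => (1 : ℝ) • v) h2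

/-- A left-invariant Randers metric of Douglas type has the same geodesic vectors as its
Riemannian metric. -/
lemma IsDouglas.isGeodesicVector_iff (hm : IsLeftInvariant m)
    (hX : Real.sqrt (innerOne m X X) < 1) (hD : IsDouglas (randers m X))
    {Y : EuclideanSpace ℝ (Fin n)} (hY : Y ≠ 0) :
    IsGeodesicVector (randers m X) (Y : GroupLieAlgebra (𝓡 n) G) ↔
      ∀ z, innerOne m Y (groupBracket G Y z) = 0 := by
  have hα := Real.sqrt_pos.2 (innerOne_pos m Y hY)
  have h0 : (∀ z, innerOne m Y (groupBracket G Y z) = 0) ↔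
      ∀ z, randersNormDeriv (innerOne m) X Y (groupBracket G Y z) = 0 := by
    refine forall_congr' fun z => ?_
    rw [randersNormDeriv, _root_.add_apply, hD.innerOne_groupBracket_eq_zero hm hX, add_zero,
      _root_.smul_apply, smul_eq_mul, mul_eq_zero, or_iff_right (inv_ne_zero hα.ne')]
  rw [h0]
  constructor
  · rintro ⟨-, γ, hγ0, hγ, -, hgeo⟩
    have hφ : chartAt (EuclideanSpace ℝ (Fin n)) (γ 0) ∈ IsManifold.maximalAtlas (𝓡 n) ∞ G :=
      IsManifold.chart_mem_maximalAtlas _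
    have ht := mem_chart_source (EuclideanSpace ℝ (Fin n)) (γ 0)
    exact (geodesic_equation_iff hm hX hφ hY hγ ht).1 (hgeo _ hφ 0 ht)
  · intro h
    obtain ⟨γ, hγ0, hγ⟩ := exists_isMIntegralCurve_mulInvariantVectorField (G := G) Y
    exact ⟨hY, γ, hγ0, hγ, contMDiff_two_of_isMIntegralCurve hγ, fun φ hφ t ht =>
      (geodesic_equation_iff hm hX hφ hY hγ ht).2 h⟩

end Douglas

/-! ### The algebraic criterion for `𝔩₅,₇`. -/

section L57

/-- The vectors `Y` with `⟪Y, [Y, Z]⟫ = 0` for all `Z` in the Lie algebra `𝔩₅,₇`. -/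
lemma IsL57Basis.forall_apply_lie_eq_zero_iff {L : Type*} [LieRing L] [LieAlgebra ℝ L]
    {E : Module.Basis (Fin 5) ℝ L} {a b c d f g : ℝ} (hE : IsL57Basis E a b c d f g)
    {B : L →ₗ[ℝ] L →ₗ[ℝ] ℝ} (horth : ∀ i j, B (E i) (E j) = if i = j then 1 else 0)
    (y : Fin 5 → ℝ) :
    (∀ z, B (∑ i, y i • E i) ⁅∑ i, y i • E i, z⁆ = 0) ↔
      (∑ i, y i • E i) ∈ Submodule.span ℝ {E 0, E 1} ∨
      (B (∑ i, y i • E i) (E 0) = 0 ∧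
        y 1 * (a * y 2 + b * y 3 + c * y 4) + y 2 * (d * y 3 + f * y 4) + g * y 3 * y 4 = 0) := by
  obtain ⟨ha, hd, hg, -, h12, h13, h14, h15, h23, h24, h25, h34, h35, h45⟩ := hE
  have hB0 : B (∑ i, y i • E i) (E 0) = y 0 := by
    simp [Fin.sum_univ_five, horth]
  -- The coordinate `z 4` is absent because `E 4` is central; every term without `z 0` carries the
  -- factor `y 0`.
  have hcoord : ∀ z : Fin 5 → ℝ, B (∑ i, y i • E i) ⁅∑ i, y i • E i, ∑ i, z i • E i⁆ =
      -z 0 * (y 1 * (a * y 2 + b * y 3 + c * y 4) + y 2 * (d * y 3 + f * y 4) + g * y 3 * y 4)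
      + y 0 * (z 1 * (a * y 2 + b * y 3 + c * y 4) + z 2 * (d * y 3 + f * y 4)
        + z 3 * (g * y 4)) := by
    intro z
    have r : ∀ i j, ⁅E i, E j⁆ = -⁅E j, E i⁆ := fun i j => (lie_skew _ _).symm
    simp only [Fin.sum_univ_five, lie_add, add_lie, lie_smul, smul_lie, lie_self, h12, h13, h14,
      h15, h23, h24, h25, h34, h35, h45, r 1 0, r 2 0, r 3 0, r 4 0, r 2 1, r 3 1, r 4 1, r 3 2,
      r 4 2, r 4 3, smul_zero, neg_zero, add_zero, zero_add, map_add, map_smul, map_neg,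
      smul_add, smul_neg, LinearMap.add_apply, LinearMap.smul_apply, horth, smul_eq_mul]
    simp
    ring
  have hforall : (∀ z, B (∑ i, y i • E i) ⁅∑ i, y i • E i, z⁆ = 0) ↔
      ∀ z : Fin 5 → ℝ, B (∑ i, y i • E i) ⁅∑ i, y i • E i, ∑ i, z i • E i⁆ = 0 :=
    ⟨fun h z => h _, fun h z => by rw [← E.sum_repr z]; exact h _⟩
  rw [hforall, hB0]
  simp only [hcoord]
  have hspan : (∑ i, y i • E i) ∈ Submodule.span ℝ {E 0, E 1} ↔ y 2 = 0 ∧ y 3 = 0 ∧ y 4 = 0 := by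
    rw [Submodule.mem_span_pair]
    constructor
    · rintro ⟨s, t, h⟩
      have hr : ∀ i, E.repr (s • E 0 + t • E 1) i = y i := by
        intro i
        rw [h, Module.Basis.repr_sum_self]
      simp only [map_add, map_smul, Module.Basis.repr_self] at hr
      exact ⟨by simpa using (hr 2).symm, by simpa using (hr 3).symm, by simpa using (hr 4).symm⟩
    · rintro ⟨h2, h3, h4⟩
      exact ⟨y 0, y 1, by simp [Fin.sum_univ_five, h2, h3, h4]⟩
  rw [hspan]
  constructor
  · intro h
    by_cases h0 : y 0 = 0
    · refine Or.inr ⟨h0, ?_⟩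
      have := h ![1, 0, 0, 0, 0]
      simp [h0] at this
      linarith
    · refine Or.inl ?_
      -- For `y 0 ≠ 0` the tests `E 3`, `E 2`, `E 1` form a triangular system with diagonal `g`,
      -- `d`, `a`, giving `y 4 = y 3 = y 2 = 0` in that order.
      have e1 := h ![0, 1, 0, 0, 0]
      have e2 := h ![0, 0, 1, 0, 0]
      have e3 := h ![0, 0, 0, 1, 0]
      simp [h0] at e1 e2 e3
      have e4 : y 4 = 0 := e3.resolve_left hg.ne'
      have e5 : y 3 = 0 := by simpa [e4, hd.ne'] using e2
      exact ⟨by simpa [e4, e5, ha.ne'] using e1, e5, e4⟩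
  · rintro (⟨h2, h3, h4⟩ | ⟨h0, h1⟩) z
    · simp [h2, h3, h4]
    · rw [h0, h1]
      ring

end L57

end

end DouglasRanders

theorem mainTheorem10 {G : Type*} [TopologicalSpace G]
    [ChartedSpace (EuclideanSpace ℝ (Fin 5)) G] [Group G] [LieGroup (𝓡 5) ∞ G]
    (a b c d f g : ℝ) (E : Module.Basis (Fin 5) ℝ (GroupLieAlgebra (𝓡 5) G))
    (hE : DouglasRanders.IsL57Basis E a b c d f g)
    (m : DouglasRanders.RiemMetric 5 G) (hm : DouglasRanders.IsLeftInvariant m)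
    (horth : ∀ i j, m.inner 1 (E i) (E j) = if i = j then 1 else 0)
    (X : GroupLieAlgebra (𝓡 5) G) (hX : Real.sqrt (m.inner 1 X X) < 1)
    (hD : DouglasRanders.IsDouglas (DouglasRanders.randers m X))
    (Y : GroupLieAlgebra (𝓡 5) G) (hY : Y ≠ 0)
    (y : Fin 5 → ℝ) (hy : Y = ∑ i, y i • E i) :
    DouglasRanders.IsGeodesicVector (DouglasRanders.randers m X) Y ↔
      Y ∈ Submodule.span ℝ {E 0, E 1} ∨
      (m.inner 1 Y (E 0) = 0 ∧
        y 1 * (a * y 2 + b * y 3 + c * y 4) + y 2 * (d * y 3 + f * y 4) + g * y 3 * y 4 = 0) := by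
  have := DouglasRanders.lieGroup_minSmoothness (n := 5) (G := G)
  refine (hD.isGeodesicVector_iff hm hX hY).trans ?_
  subst hy
  exact hE.forall_apply_lie_eq_zero_iff
    (B := (ContinuousLinearMap.coeLM ℝ).comp (m.inner 1).toLinearMap) horth y
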